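/- For $v\in\mathbb{R}^n$, $n\ge 1$, let $\Delta_c v := [v_2-v_1,\dots,v_n-v_{n-1},v_1-v_n]^\top$ be its cyclic forward difference, let $\operatorname{sign}(v)$ be the entrywise sign (with $\operatorname{sign}(0)=0$), and let $H_v\in\mathbb{R}^{n\times n}$ be the circulant matrix with first column $v$, i.e. $(H_v)_{ij}=v_{i-j+1}$ with indices modulo $n$. For a finite real vector $x$, let $S^-(x)$ be the number of sign changes in the vector obtained from $x$ by deleting all zeros (the number of pairs of neighbouring entries with negative product), with $S^-(0):=-1$. Put $$S_c^-(v):=\max_{1\le i\le n} S^-([v_i,\dots,v_n,v_1,\dots,v_i]),\qquad S_c^+(v):=\max_{\bar v} S_c^-(\bar v),$$ where $\bar v$ ranges over all vectors in $\mathbb{R}^n$ obtained from $v$ by replacing its zero entries by arbitrary real numbers. **Lemma.** Let $v\in\mathbb{R}^n$ satisfy $S_c^+(v)\le 2$. Then for every $w\in\mathbb{R}^n$ with $S_c^-(\Delta_c w)\le 2$, $$S_c^-\bigl(\Delta_c (H_{\operatorname{sign}(v)}\, w)\bigr)\le 2 .$$ -/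

import Mathlib

/-- The strict variation `S⁻` of a finite list of reals: delete all zeros and count the pairs of
neighbouring entries with negative product. If there is no nonzero entry the value is `-1`. -/
noncomputable def strictVariation (l : List ℝ) : ℤ :=
  let t := l.filter (fun x => x ≠ 0)
  if t = [] then -1 else ((t.zip t.tail).countP (fun p => p.1 * p.2 < 0) : ℤ)

/-- The list `[v i, v (i+1), …, v (i+n)]` of length `n + 1`, indices modulo `n`; its first and its
last entries are both `v i`. -/
def cyclicWindow {n : ℕ} [NeZero n] (v : Fin n → ℝ) (i : Fin n) : List ℝ :=
  List.ofFn (fun k : Fin (n + 1) => v (i + Fin.ofNat n k))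

/-- The strict cyclic variation `S_c⁻(v)`. -/
noncomputable def cyclicStrictVariation {n : ℕ} [NeZero n] (v : Fin n → ℝ) : ℤ :=
  ⨆ i : Fin n, strictVariation (cyclicWindow v i)

/-- `u` arises from `v` by replacing zero entries of `v` by arbitrary real numbers. -/
def IsZeroFilling {n : ℕ} (v u : Fin n → ℝ) : Prop :=
  ∀ j, v j ≠ 0 → u j = v j

/-- The weak cyclic variation `S_c⁺(v)`: the largest number of cyclic sign changes that can be
attained by replacing the zero entries of `v` by real numbers. The entry `v i` that occurs at both
ends of the window is one entry of `v`, so it is replaced by one and the same number. -/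
noncomputable def cyclicWeakVariation {n : ℕ} [NeZero n] (v : Fin n → ℝ) : ℤ :=
  ⨆ i : Fin n, ⨆ u : {u : Fin n → ℝ // IsZeroFilling v u},
    strictVariation (cyclicWindow u.1 i)

/-- The cyclic forward difference operator `Δ_c`. -/
def cyclicDiff {n : ℕ} [NeZero n] (v : Fin n → ℝ) : Fin n → ℝ :=
  fun i => v (i + 1) - v i

/-- The number of sign changes is bounded by the length of the list. -/
theorem strictVariation_le_length (l : List ℝ) : strictVariation l ≤ l.length := by
  unfold strictVariation
  dsimp only
  split_ifs
  · omega
  · have h1 := List.countP_le_length (p := fun p : ℝ × ℝ => decide (p.1 * p.2 < 0))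
      (l := (l.filter (fun x => x ≠ 0)).zip (l.filter (fun x => x ≠ 0)).tail)
    have h2 := List.length_filter_le (fun x : ℝ => decide (x ≠ 0)) l
    rw [List.length_zip] at h1
    exact_mod_cast (h1.trans (min_le_left _ _)).trans h2

/-- The inner supremum in `cyclicWeakVariation` is over a set that is bounded above. -/
theorem bddAbove_strictVariation_fillings {n : ℕ} [NeZero n] (v : Fin n → ℝ) (i : Fin n) :
    BddAbove (Set.range fun u : {u : Fin n → ℝ // IsZeroFilling v u} =>
      strictVariation (cyclicWindow u.1 i)) := by
  refine ⟨((n + 1 : ℕ) : ℤ), ?_⟩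
  rintro _ ⟨u, rfl⟩
  simpa [cyclicWindow] using strictVariation_le_length (cyclicWindow u.1 i)

/-! At most two cyclic sign changes of `cyclicDiff w` means that the periodic extension of `w` rises
and then falls over one period (`exists_isUnimodalOn`). Unless `sign v` vanishes, after a global
change of sign it is the mean of two ±1 square waves, -1 on `[b, c)` and on `[b', c')`, whose
endpoints differ by at most one (`exists_squareWave`). Convolving them with the differences of `w`
telescopes (`sum_squareWave`) to `(w (i+1-c) + w (i+1-c')) - (w (i+1-b) + w (i+1-b'))`. Each bracket
adds equal or neighbouring values of `w`, so it is one value of `doubledGrid w`, which is again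
unimodal, with period `2 * n`. The expression is thus a difference of two translates of a unimodal
sequence, and such a difference changes sign at most twice per period
(`IsUnimodalOn.not_hasAlternation_shift`). -/

/-! ### Sign changes of lists and alternating sublists. -/

open List in
theorem exists_alternating_sublist (x : ℝ) (t : List ℝ) (h : ∀ y ∈ x :: t, y ≠ 0) :
    ∃ r : List ℝ, (x :: r) <+ (x :: t) ∧ (x :: r).IsChain (fun y z => y * z < 0) ∧
      r.length = ((x :: t).zip t).countP (fun p => p.1 * p.2 < 0) := by
  induction t generalizing x with
  | nil => exact ⟨[], by simp⟩
  | cons y t ih =>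
    obtain ⟨r, h1, h2, h3⟩ := ih y (fun z hz => h z (List.mem_cons_of_mem _ hz))
    have hx : x ≠ 0 := h x (by simp)
    have hy : y ≠ 0 := h y (by simp)
    by_cases hxy : x * y < 0
    · refine ⟨y :: r, h1.cons_cons x, List.isChain_cons_cons.2 ⟨hxy, h2⟩, ?_⟩
      rw [List.zip_cons_cons, List.countP_cons_of_pos (by simpa using hxy)]
      simp [h3]
    -- Here `x` and `y` have the same sign, so `x` takes the place of `y` at the head of the chain.
    · refine ⟨r, ?_, ?_, ?_⟩
      · exact ((List.sublist_cons_self y r).trans h1).cons_cons x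
      · cases r with
        | nil => simp
        | cons z r =>
          rw [List.isChain_cons_cons] at h2 ⊢
          refine ⟨?_, h2.2⟩
          have hpos : 0 < x * y := lt_of_le_of_ne (not_lt.1 hxy) (mul_ne_zero hx hy).symm
          by_contra hxz
          rcases pos_and_pos_or_neg_and_neg_of_mul_pos hpos with ⟨ha, hb⟩ | ⟨ha, hb⟩ <;> nlinarith [h2.1]
      · rw [List.zip_cons_cons, List.countP_cons_of_neg (by simpa using hxy)]
        exact h3

open List in
theorem length_alternating_sublist_le (x : ℝ) (t : List ℝ) (h : ∀ y ∈ x :: t, y ≠ 0)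
    (r : List ℝ) (hr : r <+ (x :: t)) (hc : r.IsChain (fun y z => y * z < 0)) :
    r.length ≤ ((x :: t).zip t).countP (fun p => p.1 * p.2 < 0) + 1 := by
  induction t generalizing x r with
  | nil => simpa using hr.length_le
  | cons y t ih =>
    have hx : x ≠ 0 := h x (by simp)
    have hy : y ≠ 0 := h y (by simp)
    have ih' := ih y (fun z hz => h z (List.mem_cons_of_mem _ hz))
    rw [List.zip_cons_cons, List.countP_cons]
    cases hr with
    | cons _ hr => exact (ih' r hr hc).trans (by omega)
    | @cons_cons r' _ _ hr =>
      have h2 := ih' r' hr hc.tail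
      by_cases hxy : x * y < 0
      · simp only [hxy, decide_true, if_true, List.length_cons]
        omega
      · cases r' with
        | nil => simp
        | cons z r =>
          have hpos : 0 < x * y := lt_of_le_of_ne (not_lt.1 hxy) (mul_ne_zero hx hy).symm
          rw [List.isChain_cons_cons] at hc
          have hyz : y * z < 0 := by
            by_contra hyz
            rcases pos_and_pos_or_neg_and_neg_of_mul_pos hpos with ⟨ha, hb⟩ | ⟨ha, hb⟩ <;>
              nlinarith [hc.1]
          have hzy : z ≠ y := by
            rintro rfl
            nlinarith [mul_self_nonneg z]
          have hsub : (z :: r) <+ t := by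
            cases hr with
            | cons _ hr => exact hr
            | cons_cons _ hr => exact absurd rfl hzy
          -- As `y` has the sign of `x`, it can replace `x` as head, which gives an alternating
          -- sublist of `y :: t` of the same length.
          have := ih' (y :: z :: r) (hsub.cons_cons y) (List.isChain_cons_cons.2 ⟨hyz, hc.2⟩)
          simp only [List.length_cons] at this ⊢
          omega

/-- At least three strict sign changes amount to an alternating quadruple of entries. -/
theorem three_le_strictVariation_iff (l : List ℝ) :
    3 ≤ strictVariation l ↔ ∃ a b c d : Fin l.length, a < b ∧ b < c ∧ c < d ∧
      l.get a * l.get b < 0 ∧ l.get b * l.get c < 0 ∧ l.get c * l.get d < 0 := by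
  have hne : ∀ y ∈ l.filter (fun x => x ≠ 0), y ≠ 0 := fun y hy => by
    simpa using (List.mem_filter.1 hy).2
  have hsl : (l.filter (fun x => x ≠ 0)).Sublist l := List.filter_sublist
  constructor
  · intro h
    unfold strictVariation at h
    generalize l.filter (fun x => x ≠ 0) = t at hne hsl h
    cases t with
    | nil => simp at h
    | cons x t =>
      obtain ⟨r, h1, h2, h3⟩ := exists_alternating_sublist x t hne
      simp only [List.tail_cons, reduceCtorEq, if_false] at h
      rw [← h3] at h
      obtain ⟨f, hf⟩ := List.sublist_iff_exists_fin_orderEmbedding_get_eq.1 (h1.trans hsl)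
      match r, h2, h, f, hf with
      | y :: z :: u :: r, h2, _, f, hf =>
        refine ⟨f ⟨0, by simp⟩, f ⟨1, by simp⟩, f ⟨2, by simp⟩, f ⟨3, by simp⟩,
          f.strictMono (by simp), f.strictMono (by simp [Fin.lt_def]),
          f.strictMono (by simp [Fin.lt_def]), ?_⟩
        simp only [← hf]
        simp only [List.isChain_cons_cons] at h2
        exact ⟨h2.1, h2.2.1, h2.2.2.1⟩
      | [], _, h, _, _ => simp at h
      | [_], _, h, _, _ => simp at h
      | [_, _], _, h, _, _ => simp at h
  · rintro ⟨a, b, c, d, hab, hbc, hcd, h1, h2, h3⟩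
    have hs : [l.get a, l.get b, l.get c, l.get d].Sublist l := by
      have := List.map_getElem_sublist (l := l) (is := [a, b, c, d]) (by
        simp [hab, hbc, hcd, hab.trans hbc, hbc.trans hcd, (hab.trans hbc).trans hcd])
      simpa using this
    have ha : l.get a ≠ 0 := left_ne_zero_of_mul h1.ne
    have hb : l.get b ≠ 0 := right_ne_zero_of_mul h1.ne
    have hc : l.get c ≠ 0 := right_ne_zero_of_mul h2.ne
    have hd : l.get d ≠ 0 := right_ne_zero_of_mul h3.ne
    have hs' := hs.filter (fun x => x ≠ 0)
    rw [List.filter_eq_self.2 (by simp_all)] at hs'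
    unfold strictVariation
    generalize l.filter (fun x => x ≠ 0) = t at hne hs'
    cases t with
    | nil => simp at hs'
    | cons x t =>
      have := length_alternating_sublist_le x t hne _ hs'
        (by simp only [List.isChain_cons_cons]; exact ⟨h1, h2, h3, by simp⟩)
      simp only [List.tail_cons, reduceCtorEq, if_false]
      simp only [List.length_cons, List.length_nil] at this
      omega

/-! ### Alternating quadruples of periodic sequences. -/

/-- `f` alternates strictly in sign at the indices `a < b < c < d` of one period. -/
def HasAlternation (f : ℤ → ℝ) (n m : ℤ) : Prop :=
  ∃ a b c d : ℤ, m ≤ a ∧ a < b ∧ b < c ∧ c < d ∧ d < m + n ∧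
    f a * f b < 0 ∧ f b * f c < 0 ∧ f c * f d < 0

/-- Three sign changes in a row leave the ends with opposite signs, so the quadruple also alternates
cyclically. This is what lets a window be rotated. -/
theorem alternation_closing {x y z t : ℝ} (h1 : x * y < 0) (h2 : y * z < 0) (h3 : z * t < 0) :
    t * x < 0 := by
  rcases mul_neg_iff.1 h1 with h | h <;> rcases mul_neg_iff.1 h2 with h' | h' <;>
    rcases mul_neg_iff.1 h3 with h'' | h'' <;> first | (exfalso; linarith) | nlinarith

theorem HasAlternation.succ {f : ℤ → ℝ} {n m : ℤ} (hf : Function.Periodic f n)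
    (h : HasAlternation f n m) : HasAlternation f n (m + 1) := by
  obtain ⟨a, b, c, d, hm, hab, hbc, hcd, hd, h1, h2, h3⟩ := h
  rcases hm.eq_or_lt with rfl | hm
  · refine ⟨b, c, d, m + n, by lia, hbc, hcd, hd, by lia, h2, h3, ?_⟩
    rw [hf m]
    exact alternation_closing h1 h2 h3
  · exact ⟨a, b, c, d, by lia, hab, hbc, hcd, by lia, h1, h2, h3⟩

theorem HasAlternation.pred {f : ℤ → ℝ} {n m : ℤ} (hf : Function.Periodic f n)
    (h : HasAlternation f n m) : HasAlternation f n (m - 1) := by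
  obtain ⟨a, b, c, d, hm, hab, hbc, hcd, hd, h1, h2, h3⟩ := h
  by_cases hd' : d < m - 1 + n
  · exact ⟨a, b, c, d, by lia, hab, hbc, hcd, hd', h1, h2, h3⟩
  · obtain rfl : d = m - 1 + n := by lia
    rw [hf] at h3
    exact ⟨m - 1, a, b, c, le_rfl, by lia, hab, hbc, hcd, alternation_closing h1 h2 h3, h1, h2⟩

theorem HasAlternation.of_periodic {f : ℤ → ℝ} {n m : ℤ} (hf : Function.Periodic f n)
    (h : HasAlternation f n m) (m' : ℤ) : HasAlternation f n m' := by
  induction m' using Int.inductionOn' (b := m) with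
  | zero => exact h
  | succ k _ ih => exact ih.succ hf
  | pred k _ ih => exact ih.pred hf

/-! ### Cyclically unimodal sequences. -/

/-- `W` increases from `m` to `M` and decreases from `M` to `m + n`. -/
structure IsUnimodalOn (W : ℤ → ℝ) (n m M : ℤ) : Prop where
  le_left : m ≤ M
  le_right : M ≤ m + n
  mono : ∀ i, m ≤ i → i < M → W i ≤ W (i + 1)
  anti : ∀ i, M ≤ i → i < m + n → W (i + 1) ≤ W i

theorem IsUnimodalOn.monotone {W : ℤ → ℝ} {n m M : ℤ} (h : IsUnimodalOn W n m M) {i j : ℤ}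
    (hi : m ≤ i) (hij : i ≤ j) (hj : j ≤ M) : W i ≤ W j := by
  induction j, hij using Int.leInduction with
  | base => rfl
  | succ k hk ih => exact (ih (by lia)).trans (h.mono k (by lia) (by lia))

theorem IsUnimodalOn.antitone {W : ℤ → ℝ} {n m M : ℤ} (h : IsUnimodalOn W n m M) {i j : ℤ}
    (hi : M ≤ i) (hij : i ≤ j) (hj : j ≤ m + n) : W j ≤ W i := by
  induction j, hij using Int.leInduction with
  | base => rfl
  | succ k hk ih => exact (h.anti k (by lia) (by lia)).trans (ih (by lia))

theorem exists_lt_succ {w : ℤ → ℝ} {i j : ℤ} (hij : i ≤ j) (h : w i < w j) :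
    ∃ k, i ≤ k ∧ k < j ∧ 0 < w (k + 1) - w k := by
  by_contra! hk
  have : ∀ l, i ≤ l → l ≤ j → w l ≤ w i := by
    intro l hl
    induction l, hl using Int.leInduction with
    | base => intro _; rfl
    | succ k hk' ih =>
      intro hkj
      have := hk k hk' (by lia)
      have := ih (by lia)
      linarith
  exact (this j hij le_rfl).not_gt h

theorem exists_succ_lt {w : ℤ → ℝ} {i j : ℤ} (hij : i ≤ j) (h : w j < w i) :
    ∃ k, i ≤ k ∧ k < j ∧ w (k + 1) - w k < 0 := by
  obtain ⟨k, h1, h2, h3⟩ := exists_lt_succ (w := fun k => -w k) hij (by simpa using h)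
  exact ⟨k, h1, h2, by linarith⟩

/-- A periodic sequence whose difference does not alternate is cyclically unimodal. -/
theorem exists_isUnimodalOn {w : ℤ → ℝ} {n : ℤ} (hn : 0 < n) (hw : Function.Periodic w n)
    (h : ∀ m, ¬ HasAlternation (fun i => w (i + 1) - w i) n m) :
    ∃ m M, IsUnimodalOn w n m M := by
  have hmin : ∃ m, ∀ i, w m ≤ w i := by
    obtain ⟨m, -, hm⟩ := (Finset.Ico 0 n).exists_min_image w ⟨0, by simp [hn]⟩
    refine ⟨m, fun i => ?_⟩
    have h1 := hw.int_mul (i / n) (i % n)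
    rw [Int.cast_id, mul_comm, Int.emod_add_mul_ediv] at h1
    rw [h1]
    exact hm _ (by simp [Int.emod_nonneg _ hn.ne', Int.emod_lt_of_pos _ hn])
  obtain ⟨m, hm⟩ := hmin
  obtain ⟨M, hMm, hM⟩ := (Finset.Icc m (m + n)).exists_max_image w ⟨m, by simp [hn.le]⟩
  rw [Finset.mem_Icc] at hMm
  have hM' : ∀ i, m ≤ i → i ≤ m + n → w i ≤ w M := fun i h1 h2 => hM i (by simp [h1, h2])
  have hmn : w (m + n) = w m := hw m
  refine ⟨m, M, hMm.1, hMm.2, fun j h1 h2 => ?_, fun j h1 h2 => ?_⟩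
  -- A descent at `j` before the maximum `M` has an ascent on each side, as `w m` is minimal and `w
  -- M` maximal; the return from `M` to `m + n` adds a final descent.
  · by_contra! hj
    have hjM := hM' j h1 (by lia)
    have hmj := hm (j + 1)
    obtain ⟨i, hi1, hi2, hi⟩ := exists_lt_succ h1 (hmj.trans_lt hj)
    obtain ⟨k, hk1, hk2, hk⟩ := exists_lt_succ (i := j + 1) (j := M) (by lia) (hj.trans_le hjM)
    obtain ⟨l, hl1, hl2, hl⟩ := exists_succ_lt (w := w) (i := M) (j := m + n) (by lia)
      (by linarith)
    exact h m ⟨i, j, k, l, hi1, hi2, by lia, by lia, hl2, mul_neg_of_pos_of_neg hi (by linarith),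
      mul_neg_of_neg_of_pos (by linarith) hk, mul_neg_of_pos_of_neg hk hl⟩
  -- Likewise an ascent at `j` after `M` lies between two descents, and the climb from `m` to `M`
  -- precedes them.
  · by_contra! hj
    have hjM := hM' (j + 1) (by lia) (by lia)
    have hmj := hm j
    obtain ⟨i, hi1, hi2, hi⟩ := exists_succ_lt h1 (hj.trans_le hjM)
    obtain ⟨k, hk1, hk2, hk⟩ := exists_succ_lt (w := w) (i := j + 1) (j := m + n) (by lia)
      (by linarith)
    obtain ⟨l, hl1, hl2, hl⟩ := exists_lt_succ (w := w) (i := m) (j := M) (by lia) (by linarith)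
    exact h m ⟨l, i, j, k, hl1, by lia, by lia, by lia, hk2, mul_neg_of_pos_of_neg hl hi,
      mul_neg_of_neg_of_pos hi (by linarith), mul_neg_of_pos_of_neg (by linarith) hk⟩

/-- The difference of two translates of a cyclically unimodal sequence does not alternate. -/
theorem IsUnimodalOn.not_hasAlternation_shift {W : ℤ → ℝ} {n m M : ℤ} (hn : 0 < n)
    (hW : Function.Periodic W n) (h : IsUnimodalOn W n m M) (p : ℤ) (m' : ℤ) :
    ¬ HasAlternation (fun i => W (i + p) - W i) n m' := by
  wlog hp : 0 ≤ p ∧ p < n generalizing p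
  · have := this (p % n) ⟨Int.emod_nonneg _ hn.ne', Int.emod_lt_of_pos _ hn⟩
    convert this using 3 with i
    have h1 := hW.int_mul (p / n) (i + p % n)
    rw [Int.cast_id] at h1
    rw [← h1, show i + p % n + p / n * n = i + p by linear_combination Int.emod_add_mul_ediv p n]
  obtain ⟨hp0, hpn⟩ := hp
  -- On the rising branch the difference cannot go from negative to positive: a negative value puts
  -- `i + p` past the peak, and from there `W (j + p)` falls until it wraps around to the rising
  -- branch at a point not after `j`.
  have left : ∀ i j, m ≤ i → i < j → j ≤ M → W (i + p) - W i < 0 → W (j + p) - W j ≤ 0 := by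
    intro i j hi hij hj hneg
    have hip : M < i + p := by
      by_contra! hc
      have := h.monotone hi (by lia : i ≤ i + p) hc
      linarith
    have hij' := h.monotone hi hij.le hj
    by_cases hjp : j + p ≤ m + n
    · have := h.antitone hip.le (by lia : i + p ≤ j + p) hjp
      linarith
    · have := h.monotone (by lia : m ≤ j + p - n) (by lia : j + p - n ≤ j) hj
      rw [hW.sub_eq] at this
      linarith
  -- Mirror image: on the falling branch the difference cannot go from positive to negative.
  have right : ∀ i j, M ≤ i → i < j → j < m + n → 0 < W (i + p) - W i → 0 ≤ W (j + p) - W j := by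
    intro i j hi hij hj hpos
    have hip : m + n < i + p := by
      by_contra! hc
      have := h.antitone hi (by lia : i ≤ i + p) hc
      linarith
    have hij' := h.antitone hi hij.le hj.le
    by_cases hjp : j + p - n ≤ M
    · have := h.monotone (by lia : m ≤ i + p - n) (by lia : i + p - n ≤ j + p - n) hjp
      rw [hW.sub_eq, hW.sub_eq] at this
      linarith
    · have := h.antitone (by lia : M ≤ j + p - n) (by lia : j + p - n ≤ j) hj.le
      rw [hW.sub_eq] at this
      linarith
  intro halt
  have hper : Function.Periodic (fun i => W (i + p) - W i) n := fun i => by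
    simp only [add_right_comm i n p, hW _]
  obtain ⟨a, b, c, d, ha, hab, hbc, hcd, hd, h1, h2, h3⟩ := halt.of_periodic hper m
  simp only at h1 h2 h3
  -- A change from - to + must end beyond `M` by `left`; the change back to - then contradicts
  -- `right`.
  rcases mul_neg_iff.1 h2 with hs | hs
  · rcases mul_neg_iff.1 h1 with hs1 | hs1
    · linarith
    have hbM : M < b := by
      by_contra! hc
      exact (left a b ha hab hc hs1.1).not_gt hs1.2
    exact (right b c hbM.le hbc (by lia) hs.1).not_gt hs.2
  · rcases mul_neg_iff.1 h3 with hs1 | hs1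
    swap
    · linarith
    have hcM : M < c := by
      by_contra! hc
      exact (left b c (by lia) hbc hc hs.1).not_gt hs.2
    exact (right c d hcM.le hcd hd hs1.1).not_gt hs1.2

/-! ### The doubled grid. -/

/-- The sequence of pairwise sums on the doubled grid. -/
def doubledGrid (w : ℤ → ℝ) (k : ℤ) : ℝ := w (k / 2) + w ((k + 1) / 2)

theorem doubledGrid_periodic {w : ℤ → ℝ} {n : ℤ} (hw : Function.Periodic w n) :
    Function.Periodic (doubledGrid w) (2 * n) := by
  intro k
  unfold doubledGrid
  rw [show (k + 2 * n) / 2 = k / 2 + n by lia, show (k + 2 * n + 1) / 2 = (k + 1) / 2 + n by lia,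
    hw, hw]

theorem doubledGrid_add (w : ℤ → ℝ) {x y : ℤ} (h : y = x ∨ y = x + 1) :
    doubledGrid w (x + y) = w x + w y := by
  unfold doubledGrid
  rw [show (x + y) / 2 = x by lia, show (x + y + 1) / 2 = y by lia]

/-- Each increment of `w` occurs exactly twice in a row as an increment of the doubled sequence. -/
theorem IsUnimodalOn.doubledGrid {w : ℤ → ℝ} {n m M : ℤ} (h : IsUnimodalOn w n m M) :
    IsUnimodalOn (doubledGrid w) (2 * n) (2 * m) (2 * M) := by
  have key : ∀ i, _root_.doubledGrid w (i + 1) - _root_.doubledGrid w i =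
      w (i / 2 + 1) - w (i / 2) := by
    intro i
    unfold _root_.doubledGrid
    rw [show (i + 1 + 1) / 2 = i / 2 + 1 by lia]
    ring
  have h1 := h.le_left
  have h2 := h.le_right
  refine ⟨by lia, by lia, fun i hi hi' => ?_, fun i hi hi' => ?_⟩
  · have := h.mono (i / 2) (by lia) (by lia)
    linarith [key i]
  · have := h.anti (i / 2) (by lia) (by lia)
    linarith [key i]

/-- Differences of sums over neighbouring translates of a unimodal sequence do not alternate. -/
theorem not_hasAlternation_pair {w : ℤ → ℝ} {n : ℤ} (hn : 0 < n) (hw : Function.Periodic w n)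
    (h : ∀ m, ¬ HasAlternation (fun i => w (i + 1) - w i) n m) {b b' c c' : ℤ}
    (hb : b' = b ∨ b' = b + 1) (hc : c' = c ∨ c' = c + 1) (m : ℤ) :
    ¬ HasAlternation (fun i => (w (i - c) + w (i - c')) - (w (i - b) + w (i - b'))) n m := by
  obtain ⟨k, K, hk⟩ := exists_isUnimodalOn hn hw h
  -- On the doubled grid the two pairs sit at `2 * i - b - b'` and `2 * i - c - c'`, whence the
  -- shift and the start of the window.
  have hno := hk.doubledGrid.not_hasAlternation_shift (by lia) (doubledGrid_periodic hw)
    (b + b' - c - c') (2 * m - b - b')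
  rintro ⟨i1, i2, i3, i4, h0, h12, h23, h34, h4, hs⟩
  have key : ∀ i, (w (i - c) + w (i - c')) - (w (i - b) + w (i - b')) =
      doubledGrid w ((2 * i - b - b') + (b + b' - c - c')) - doubledGrid w (2 * i - b - b') := by
    intro i
    rw [show (2 * i - b - b') + (b + b' - c - c') = (i - c') + (i - c) by ring,
      show 2 * i - b - b' = (i - b') + (i - b) by ring, doubledGrid_add w (by lia),
      doubledGrid_add w (by lia)]
    ring
  simp only [key] at hs
  exact hno ⟨_, _, _, _, by lia, by lia, by lia, by lia, by lia, hs⟩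

/-! ### Square waves and convolution with them. -/

/-- The two-valued sequence with value `-1` on `[b, c)` and `1` elsewhere. -/
def squareWave (b c k : ℤ) : ℝ := if b ≤ k ∧ k < c then -1 else 1

theorem Int.exists_first (P : ℤ → Prop) {i j : ℤ} (hij : i ≤ j) (hj : P j) :
    ∃ k, i ≤ k ∧ k ≤ j ∧ P k ∧ ∀ l, i ≤ l → l < k → ¬ P l := by
  obtain ⟨k, ⟨hk, hPk⟩, hmin⟩ := Int.exists_least_of_bdd (P := fun k => i ≤ k ∧ P k)
    ⟨i, fun z hz => hz.1⟩ ⟨j, hij, hj⟩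
  exact ⟨k, hk, hmin j ⟨hij, hj⟩, hPk, fun l hl hlk hPl => (hmin l ⟨hl, hPl⟩).not_gt hlk⟩

/-- A sign pattern without weak alternation is the mean of two neighbouring square waves. -/
theorem exists_squareWave {n t : ℤ} (hn : 0 < n) {s : ℤ → ℝ} (hper : Function.Periodic s n)
    (hs : ∀ k, s k = 1 ∨ s k = 0 ∨ s k = -1) (ht : s t = 1)
    (hweak : ∀ a b c d, a < b → b < c → c < d → d < a + n →
      ¬ (0 ≤ s a ∧ s b ≤ 0 ∧ 0 ≤ s c ∧ s d ≤ 0)) :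
    ∃ b b' c c' : ℤ, t ≤ b ∧ b ≤ c ∧ c ≤ t + n ∧ t ≤ b' ∧ b' ≤ c' ∧ c' ≤ t + n ∧
      (b' = b ∨ b' = b + 1) ∧ (c' = c ∨ c' = c + 1) ∧
      ∀ k, t ≤ k → k < t + n → 2 * s k = squareWave b c k + squareWave b' c' k := by
  have one : ∀ k, 0 < s k → s k = 1 := fun k h => by
    rcases hs k with h' | h' | h' <;> first | exact h' | (exfalso; linarith)
  have neg : ∀ k, s k < 0 → s k = -1 := fun k h => by
    rcases hs k with h' | h' | h' <;> first | exact h' | (exfalso; linarith)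
  have htn : s (t + n) = 1 := by rw [hper, ht]
  by_cases hpos : ∀ k, t ≤ k → k < t + n → 0 < s k
  · refine ⟨t, t, t, t, by lia, by lia, by lia, by lia, by lia, by lia, by lia, by lia,
      fun k h1 h2 => ?_⟩
    rw [one k (hpos k h1 h2), squareWave, if_neg (by lia)]
    norm_num
  push Not at hpos
  obtain ⟨j, hj1, hj2, hj⟩ := hpos
  obtain ⟨b, hb1, hb2, hb, hbmin⟩ := Int.exists_first (fun k => s k ≤ 0) hj1 hj
  simp only [not_le] at hbmin
  have htb : t < b := lt_of_le_of_ne hb1 (by rintro rfl; linarith)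
  by_cases hneg : ∃ k, t ≤ k ∧ k < t + n ∧ s k < 0
  · obtain ⟨e, he1, he2, he⟩ := hneg
    obtain ⟨b', hb'1, hb'2, hb', hb'min⟩ := Int.exists_first (fun k => s k < 0) he1 he
    simp only [not_lt] at hb'min
    have hbb' : b ≤ b' := by
      by_contra! hc
      linarith [hbmin b' hb'1 hc]
    have hb'b : b' ≤ b + 1 := by
      by_contra! hc
      exact hweak t b (b + 1) b' htb (by lia) hc (by lia)
        ⟨by linarith, hb, hb'min _ (by lia) hc, hb'.le⟩
    obtain ⟨c, hc1, hc2, hc, hcmin⟩ := Int.exists_first (fun k => 0 ≤ s k)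
      (by lia : b' ≤ t + n) (by linarith)
    obtain ⟨c', hc'1, hc'2, hc', hc'min⟩ := Int.exists_first (fun k => 0 < s k) hc2 (by linarith)
    simp only [not_lt, not_le] at hcmin hc'min
    have hb'c : b' < c := lt_of_le_of_ne hc1 (by rintro rfl; linarith)
    have hc'c : c' ≤ c + 1 := by
      by_contra! h
      exact hweak t b' c (c + 1) (by lia) hb'c (by lia) (by lia)
        ⟨by linarith, hb'.le, hc, hc'min _ (by lia) h⟩
    have hend : ∀ k, c' ≤ k → k < t + n → 0 < s k := by
      intro k h1 h2
      rcases h1.eq_or_lt with rfl | h1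
      · exact hc'
      by_contra! h
      exact hweak t b' c' k (by lia) (by lia) h1 h2 ⟨by linarith, hb'.le, hc'.le, h⟩
    refine ⟨b, b', c, c', hb1, by lia, hc2, by lia, by lia, hc'2, by lia, by lia,
      fun k h1 h2 => ?_⟩
    unfold squareWave
    rcases lt_or_ge k b with h | h
    · rw [one k (hbmin k h1 h), if_neg (by lia), if_neg (by lia)]
      norm_num
    rcases lt_or_ge k b' with h' | h'
    · obtain rfl : k = b := by lia
      rw [le_antisymm hb (hb'min k h1 h'), if_pos (by lia), if_neg (by lia)]
      norm_num
    rcases lt_or_ge k c with h | h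
    · rw [neg k (hcmin k h' h), if_pos (by lia), if_pos (by lia)]
      norm_num
    rcases lt_or_ge k c' with h' | h'
    · obtain rfl : k = c := by lia
      rw [le_antisymm (hc'min k h h') hc, if_neg (by lia), if_pos (by lia)]
      norm_num
    · rw [one k (hend k h' h2), if_neg (by lia), if_neg (by lia)]
      norm_num
  · push Not at hneg
    -- Without negative values, the only possible zeros in the period are `b` and `b + 1`.
    have hend : ∀ k, b + 1 < k → k < t + n → 0 < s k := by
      intro k h1 h2
      by_contra! h
      exact hweak t b (b + 1) k htb (by lia) h1 h2
        ⟨by linarith, hb, hneg _ (by lia) (by lia), h⟩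
    have hb0 : s b = 0 := le_antisymm hb (hneg b hb1 (by lia))
    by_cases hsucc : s (b + 1) ≤ 0
    · have hlt : b + 1 ≠ t + n := by
        intro h
        rw [h, htn] at hsucc
        linarith
      have hb1' : s (b + 1) = 0 := le_antisymm hsucc (hneg _ (by lia) (by lia))
      -- Two adjacent zeros: each wave is -1 at one of them.
      refine ⟨b, b + 1, b + 1, b + 2, by lia, by lia, by lia, by lia, by lia, by lia, by lia,
        by lia, fun k h1 h2 => ?_⟩
      unfold squareWave
      rcases lt_trichotomy k b with h | rfl | h
      · rw [one k (hbmin k h1 h), if_neg (by lia), if_neg (by lia)]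
        norm_num
      · rw [hb0, if_pos (by lia), if_neg (by lia)]
        norm_num
      rcases (show b + 1 ≤ k from h).eq_or_lt with rfl | h
      · rw [hb1', if_neg (by lia), if_pos (by lia)]
        norm_num
      · rw [one k (hend k h h2), if_neg (by lia), if_neg (by lia)]
        norm_num
    · push Not at hsucc
      -- A single zero: the second wave has an empty negative part.
      refine ⟨b, b + 1, b + 1, b + 1, by lia, by lia, by lia, by lia, by lia, by lia, by lia,
        by lia, fun k h1 h2 => ?_⟩
      unfold squareWave
      rcases lt_trichotomy k b with h | rfl | h
      · rw [one k (hbmin k h1 h), if_neg (by lia), if_neg (by lia)]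
        norm_num
      · rw [hb0, if_pos (by lia), if_neg (by lia)]
        norm_num
      have hk : 0 < s k := by
        rcases (show b + 1 ≤ k from h).eq_or_lt with rfl | h
        · exact hsucc
        · exact hend k h h2
      rw [one k hk, if_neg (by lia), if_neg (by lia)]
      norm_num

theorem sum_Ico_int_telescope (g : ℤ → ℝ) {a b : ℤ} (hab : a ≤ b) :
    ∑ k ∈ Finset.Ico a b, (g k - g (k + 1)) = g a - g b := by
  induction b, hab using Int.leInduction with
  | base => simp
  | succ b hb ih =>
    have : Finset.Ico a (b + 1) = insert b (Finset.Ico a b) := by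
      ext x
      simp only [Finset.mem_insert, Finset.mem_Ico]
      lia
    rw [this, Finset.sum_insert (by simp), ih]
    ring

/-- The wave is 1 minus twice the indicator of `[b, c)`, and the constant 1 contributes nothing over
a full period. -/
theorem sum_squareWave {n t b c : ℤ} (hn : 0 < n) {g : ℤ → ℝ} (hg : Function.Periodic g n)
    (hb : t ≤ b) (hbc : b ≤ c) (hc : c ≤ t + n) :
    ∑ k ∈ Finset.Ico t (t + n), squareWave b c k * (g k - g (k + 1)) = 2 * (g c - g b) := by
  have h1 : ∀ k, squareWave b c k * (g k - g (k + 1)) =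
      (g k - g (k + 1)) - 2 * (if k ∈ Finset.Ico b c then g k - g (k + 1) else 0) := by
    intro k
    simp only [squareWave, Finset.mem_Ico]
    split_ifs <;> ring
  have h2 : Finset.Ico t (t + n) ∩ Finset.Ico b c = Finset.Ico b c :=
    Finset.inter_eq_right.2 (Finset.Ico_subset_Ico hb hc)
  simp only [h1]
  rw [Finset.sum_sub_distrib, ← Finset.mul_sum, Finset.sum_ite_mem, h2,
    sum_Ico_int_telescope g hbc, sum_Ico_int_telescope g (by lia), hg]
  ring

/-- Convolution with a sign pattern without weak alternation preserves cyclic unimodality. -/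
theorem not_hasAlternation_sum {n t : ℤ} (hn : 0 < n) {s w : ℤ → ℝ}
    (hper : Function.Periodic s n)
    (hs : ∀ k, s k = 1 ∨ s k = 0 ∨ s k = -1) (ht : s t = 1)
    (hweak : ∀ a b c d, a < b → b < c → c < d → d < a + n →
      ¬ (0 ≤ s a ∧ s b ≤ 0 ∧ 0 ≤ s c ∧ s d ≤ 0))
    (hw : Function.Periodic w n)
    (h : ∀ m, ¬ HasAlternation (fun i => w (i + 1) - w i) n m) (m : ℤ) :
    ¬ HasAlternation (fun i => ∑ k ∈ Finset.Ico t (t + n), s k * (w (i + 1 - k) - w (i - k)))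
      n m := by
  obtain ⟨b, b', c, c', hb, hbc, hc, hb', hbc', hc', hbb, hcc, hk⟩ :=
    exists_squareWave hn hper hs ht hweak
  -- The endpoints move by one because `w (i + 1 - b) = w (i - (b - 1))`.
  convert not_hasAlternation_pair hn hw h (b := b - 1) (b' := b' - 1) (c := c - 1) (c' := c' - 1)
    (by lia) (by lia) m using 2
  ext i
  have hg : Function.Periodic (fun k => w (i + 1 - k)) n := fun k => by
    have := hw.sub_eq (i + 1 - k)
    simpa only [sub_sub] using this
  have e1 := sum_squareWave hn hg hb hbc hc
  have e2 := sum_squareWave hn hg hb' hbc' hc'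
  have e3 : 2 * ∑ k ∈ Finset.Ico t (t + n), s k * (w (i + 1 - k) - w (i - k)) =
      ∑ k ∈ Finset.Ico t (t + n), squareWave b c k * (w (i + 1 - k) - w (i + 1 - (k + 1))) +
      ∑ k ∈ Finset.Ico t (t + n), squareWave b' c' k * (w (i + 1 - k) - w (i + 1 - (k + 1))) := by
    rw [Finset.mul_sum, ← Finset.sum_add_distrib]
    refine Finset.sum_congr rfl fun k hkm => ?_
    rw [Finset.mem_Ico] at hkm
    rw [← add_mul, ← hk k hkm.1 hkm.2, show i + 1 - (k + 1) = i - k by ring, mul_assoc]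
  rw [show i - (c - 1) = i + 1 - c by ring, show i - (c' - 1) = i + 1 - c' by ring,
    show i - (b - 1) = i + 1 - b by ring, show i - (b' - 1) = i + 1 - b' by ring]
  linarith

/-! ### From vectors on `Fin n` to periodic sequences on `ℤ`. -/

section
open scoped Fin.CommRing

/-- The periodic extension of a cyclic vector. -/
def periodicLift {n : ℕ} [NeZero n] (v : Fin n → ℝ) (k : ℤ) : ℝ := v (k : Fin n)

variable {n : ℕ} [NeZero n]

theorem periodicLift_periodic (v : Fin n → ℝ) : Function.Periodic (periodicLift v) n := by
  intro k
  simp [periodicLift]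

theorem intCast_fin_inj {x y : ℤ} (h : ((x : ℤ) : Fin n) = y) (h1 : x - y < n) (h2 : y - x < n) :
    x = y := by
  have h3 : (((x - y : ℤ)) : Fin n) = 0 := by
    rw [Int.cast_sub, h, sub_self]
  rw [CharP.intCast_eq_zero_iff (Fin n) n] at h3
  have := Int.eq_zero_of_abs_lt_dvd h3 (abs_lt.2 ⟨by lia, h1⟩)
  lia

theorem get_cyclicWindow (v : Fin n → ℝ) (i : Fin n) (p : Fin (cyclicWindow v i).length) :
    (cyclicWindow v i).get p = periodicLift v ((i : ℕ) + (p : ℕ)) := by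
  rw [List.get_eq_getElem]
  simp only [cyclicWindow, List.getElem_ofFn, periodicLift]
  congr 1
  push_cast
  rfl

theorem three_le_strictVariation_cyclicWindow_iff (v : Fin n → ℝ) (i : Fin n) :
    3 ≤ strictVariation (cyclicWindow v i) ↔ HasAlternation (periodicLift v) n (i : ℕ) := by
  rw [three_le_strictVariation_iff]
  have hlen : (cyclicWindow v i).length = n + 1 := by simp [cyclicWindow]
  simp only [get_cyclicWindow]
  constructor
  · rintro ⟨a, b, c, d, hab, hbc, hcd, h1, h2, h3⟩
    rw [Fin.lt_def] at hab hbc hcd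
    have hd : (d : ℕ) < n + 1 := d.2.trans_eq hlen
    -- The window repeats its first entry at the end; a quadruple using both copies would make a
    -- square negative.
    have hda : (d : ℕ) - (a : ℕ) ≠ n := by
      intro hc
      have h4 := alternation_closing h1 h2 h3
      rw [show ((i : ℕ) + (d : ℕ) : ℤ) = (i : ℕ) + (a : ℕ) + (n : ℕ) by lia,
        periodicLift_periodic v] at h4
      exact (mul_self_nonneg _).not_gt h4
    exact HasAlternation.of_periodic (m := (i : ℕ) + (a : ℕ)) (periodicLift_periodic v)
      ⟨_, _, _, _, by lia, by lia, by lia, by lia, by lia, h1, h2, h3⟩ _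
  · rintro ⟨a, b, c, d, ha, hab, hbc, hcd, hd, hs⟩
    refine ⟨⟨(a - (i : ℕ)).toNat, by lia⟩, ⟨(b - (i : ℕ)).toNat, by lia⟩,
      ⟨(c - (i : ℕ)).toNat, by lia⟩, ⟨(d - (i : ℕ)).toNat, by lia⟩,
      by rw [Fin.lt_def]; simp only; lia, by rw [Fin.lt_def]; simp only; lia,
      by rw [Fin.lt_def]; simp only; lia, ?_⟩
    simp only
    rw [Int.toNat_of_nonneg (by lia), Int.toNat_of_nonneg (by lia), Int.toNat_of_nonneg (by lia),
      Int.toNat_of_nonneg (by lia), add_sub_cancel, add_sub_cancel, add_sub_cancel, add_sub_cancel]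
    exact hs

/-- At most two strict cyclic sign changes means no alternating quadruple. -/
theorem cyclicStrictVariation_le_two_iff (v : Fin n → ℝ) :
    cyclicStrictVariation v ≤ 2 ↔ ∀ m, ¬ HasAlternation (periodicLift v) n m := by
  constructor
  · intro h m hm
    have h1 := (three_le_strictVariation_cyclicWindow_iff v 0).2
      (hm.of_periodic (periodicLift_periodic v) _)
    have h2 : strictVariation (cyclicWindow v 0) ≤ cyclicStrictVariation v :=
      le_ciSup (f := fun i : Fin n => strictVariation (cyclicWindow v i))
        (Set.finite_range _).bddAbove 0
    lia
  · intro h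
    refine ciSup_le fun i => ?_
    by_contra! hc
    exact h _ ((three_le_strictVariation_cyclicWindow_iff v i).1 hc)

/-- At most two weak cyclic sign changes exclude weak alternation. -/
theorem not_weakAlternation {v : Fin n → ℝ} (hv : cyclicWeakVariation v ≤ 2) (a b c d : ℤ)
    (hab : a < b) (hbc : b < c) (hcd : c < d) (hd : d < a + n) :
    ¬ (0 ≤ periodicLift v a ∧ periodicLift v b ≤ 0 ∧ 0 ≤ periodicLift v c ∧
      periodicLift v d ≤ 0) := by
  rintro ⟨ha', hb', hc', hd'⟩
  -- Zeros are filled with 1 at `a` and `c` and with -1 elsewhere; this is consistent since `d < a +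
  -- n` keeps the four indices distinct modulo `n`.
  set u : Fin n → ℝ := fun j =>
    if v j ≠ 0 then v j else if j = (a : Fin n) ∨ j = (c : Fin n) then 1 else -1 with hu
  have hfill : IsZeroFilling v u := fun j hj => if_pos hj
  have pos : ∀ x : ℤ, 0 ≤ periodicLift v x → (x = a ∨ x = c) → 0 < periodicLift u x := by
    intro x hx hxac
    simp only [periodicLift, hu] at hx ⊢
    split_ifs with h1 h2
    · exact lt_of_le_of_ne hx (Ne.symm h1)
    · norm_num
    · rcases hxac with rfl | rfl <;> simp at h2
  have neg : ∀ x : ℤ, periodicLift v x ≤ 0 → (x = b ∨ x = d) → periodicLift u x < 0 := by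
    intro x hx hxbd
    simp only [periodicLift, hu] at hx ⊢
    split_ifs with h1 h2
    · exact lt_of_le_of_ne hx h1
    · exfalso
      rcases h2 with h2 | h2
      · have := intCast_fin_inj h2 (by lia) (by lia)
        lia
      · have := intCast_fin_inj h2 (by lia) (by lia)
        lia
    · norm_num
  have ua := pos a ha' (Or.inl rfl)
  have ub := neg b hb' (Or.inl rfl)
  have uc := pos c hc' (Or.inr rfl)
  have ud := neg d hd' (Or.inr rfl)
  have halt : HasAlternation (periodicLift u) n a :=
    ⟨a, b, c, d, le_rfl, hab, hbc, hcd, hd, mul_neg_of_pos_of_neg ua ub,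
      mul_neg_of_neg_of_pos ub uc, mul_neg_of_pos_of_neg uc ud⟩
  have h1 := (three_le_strictVariation_cyclicWindow_iff u 0).2
    (halt.of_periodic (periodicLift_periodic u) _)
  have h2 := le_ciSup (bddAbove_strictVariation_fillings v 0) ⟨u, hfill⟩
  have h3 : _ ≤ cyclicWeakVariation v :=
    le_ciSup (f := fun i : Fin n => ⨆ u : {u : Fin n → ℝ // IsZeroFilling v u},
      strictVariation (cyclicWindow u.1 i)) (Set.finite_range _).bddAbove 0
  simp only at h2 h3
  lia

theorem sum_fin_eq_sum_Ico (F : Fin n → ℝ) (t : ℤ) :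
    ∑ x, F x = ∑ k ∈ Finset.Ico t (t + n), F (k : Fin n) := by
  have hinj : Set.InjOn (fun k : ℤ => (k : Fin n)) (Finset.Ico t (t + n)) := by
    intro x hx y hy hxy
    simp only [Finset.coe_Ico, Set.mem_Ico] at hx hy
    exact intCast_fin_inj hxy (by lia) (by lia)
  symm
  refine Finset.sum_nbij (fun k : ℤ => (k : Fin n)) (by simp) hinj ?_ (fun _ _ => rfl)
  exact Finset.surjOn_of_injOn_of_card_le _ (by simp [Set.MapsTo]) hinj (by simp)

theorem periodicLift_circulant_mulVec (s w : Fin n → ℝ) (t i : ℤ) :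
    periodicLift ((Matrix.circulant s).mulVec w) i =
      ∑ k ∈ Finset.Ico t (t + n), periodicLift s k * periodicLift w (i - k) := by
  have h := sum_fin_eq_sum_Ico (fun x => s x * w ((i : Fin n) - x)) t
  simp only [periodicLift, Matrix.mulVec, dotProduct, Matrix.circulant_apply, Int.cast_sub]
  rw [← h]
  refine Fintype.sum_equiv (Equiv.subLeft (i : Fin n)) _ _ fun x => ?_
  simp

theorem periodicLift_cyclicDiff (v : Fin n → ℝ) :
    periodicLift (cyclicDiff v) = fun i => periodicLift v (i + 1) - periodicLift v i := by
  ext i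
  simp [periodicLift, cyclicDiff]

end

/-! ### Assembling the proof. -/

theorem HasAlternation.neg {f : ℤ → ℝ} {n m : ℤ} (h : HasAlternation f n m) :
    HasAlternation (fun i => -f i) n m := by
  simpa only [HasAlternation, neg_mul_neg] using h

theorem mainTheorem7 (n : ℕ) [NeZero n] (v : Fin n → ℝ)
    (hv : cyclicWeakVariation v ≤ 2) (w : Fin n → ℝ)
    (hw : cyclicStrictVariation (cyclicDiff w) ≤ 2) :
    cyclicStrictVariation
      (cyclicDiff ((Matrix.circulant (fun i => Real.sign (v i))).mulVec w)) ≤ 2 := by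
  rw [cyclicStrictVariation_le_two_iff, periodicLift_cyclicDiff] at hw ⊢
  have hn : (0 : ℤ) < n := by exact_mod_cast Nat.pos_of_ne_zero (NeZero.ne n)
  set s : ℤ → ℝ := periodicLift (fun i => Real.sign (v i)) with hsdef
  have hsv : ∀ k, s k = Real.sign (periodicLift v k) := fun k => rfl
  have hper : Function.Periodic s n := periodicLift_periodic _
  have hs : ∀ k, s k = 1 ∨ s k = 0 ∨ s k = -1 := fun k => by
    have := Real.sign_apply_eq (periodicLift v k)
    rw [hsv]
    tauto
  have nonneg : ∀ k, 0 ≤ s k → 0 ≤ periodicLift v k := fun k hk => by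
    by_contra! h
    rw [hsv, Real.sign_of_neg h] at hk
    linarith
  have nonpos : ∀ k, s k ≤ 0 → periodicLift v k ≤ 0 := fun k hk => by
    by_contra! h
    rw [hsv, Real.sign_of_pos h] at hk
    linarith
  have hweak : ∀ a b c d : ℤ, a < b → b < c → c < d → d < a + n →
      ¬ (0 ≤ s a ∧ s b ≤ 0 ∧ 0 ≤ s c ∧ s d ≤ 0) := fun a b c d hab hbc hcd hd h =>
    not_weakAlternation hv a b c d hab hbc hcd hd
      ⟨nonneg _ h.1, nonpos _ h.2.1, nonneg _ h.2.2.1, nonpos _ h.2.2.2⟩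
  have hy : ∀ t i : ℤ,
      periodicLift ((Matrix.circulant (fun i => Real.sign (v i))).mulVec w) (i + 1) -
        periodicLift ((Matrix.circulant (fun i => Real.sign (v i))).mulVec w) i =
      ∑ k ∈ Finset.Ico t (t + n), s k * (periodicLift w (i + 1 - k) - periodicLift w (i - k)) := by
    intro t i
    rw [periodicLift_circulant_mulVec _ _ t, periodicLift_circulant_mulVec _ _ t,
      ← Finset.sum_sub_distrib]
    simp only [mul_sub, hsdef]
  intro m
  -- The convolution may be summed over any period, so it is made to start where `s` is nonzero; if
  -- the value there is -1, `s` is negated.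
  by_cases h0 : ∃ t, s t ≠ 0
  · obtain ⟨t, ht⟩ := h0
    simp only [hy t]
    rcases hs t with h | h | h
    · exact not_hasAlternation_sum hn hper hs h hweak (periodicLift_periodic w) hw m
    · exact absurd h ht
    · intro hc
      have hperneg : Function.Periodic (fun k => -s k) n := fun k => by simp only [hper k]
      refine not_hasAlternation_sum (s := fun k => -s k) (t := t) hn hperneg
        (fun k => ?_) (by simp only [h, neg_neg])
        (fun a b c d hab hbc hcd hd h' => ?_) (periodicLift_periodic w) hw m ?_
      · rcases hs k with h' | h' | h' <;> simp [h']
      -- Negation swaps the two inequalities; moving `a` one period ahead restores the original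
      -- pattern.
      · refine hweak b c d (a + n) hbc hcd hd (by lia) ?_
        rw [hper]
        exact ⟨by linarith, by linarith, by linarith, by linarith⟩
      · simpa only [neg_mul, Finset.sum_neg_distrib] using hc.neg
  · push Not at h0
    rintro ⟨a, b, c, d, -, -, -, -, -, h1, -⟩
    simp [hy 0, h0] at h1
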